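/- Let $K\ge 1$ and let $\rho$ be a state on $\mathbb{C}^K\otimes\mathbb{C}^2$, i.e. a positive semidefinite matrix with $\operatorname{Tr}\rho=1$. Let $\sigma_1,\sigma_2,\sigma_3$ be the Pauli matrices. Then $\rho$ can be written, with $K\times K$ matrices $X,Y_1,Y_2,Y_3$, in the form $$\rho = X\otimes I+\sum_{i=1}^3 Y_i\otimes\sigma_i=\begin{pmatrix} X+Y_3 & Y_1-iY_2\\ Y_1+iY_2 & X-Y_3\end{pmatrix},$$ where $X+Y_3\ge 0$ and $X-Y_3\ge 0$. For $-1\le\lambda\le 1$ let $\Psi_\lambda$ be the phase-damping channel on $2\times 2$ matrices, $$\Psi_\lambda\begin{pmatrix} r_{11}&r_{12}\\ r_{21}&r_{22}\end{pmatrix}=\begin{pmatrix} r_{11}&\lambda r_{12}\\ \lambda r_{21}&r_{22}\end{pmatrix},$$ so that $(I\otimes\Psi_\lambda)(\rho)\ge 0$. For real $p\ge 1$ put $\|A\|_p=(\operatorname{Tr}A^p)^{1/p}$ for positive semidefinite $A$, and $$m_p(x)=\left[\left(\frac{1+x}{2}\right)^p+\left(\frac{1-x}{2}\right)^p\right]^{1/p}\qquad(-1\le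 x\le 1).$$ Then for all real $p\ge 1$ and all $\lambda\in[-1,1]$, $$\|(I\otimes\Psi_\lambda)(\rho)\|_p\le 2\,m_p(\lambda)\left[\tfrac12\operatorname{Tr}(X+Y_3)^p+\tfrac12\operatorname{Tr}(X-Y_3)^p\right]^{1/p}.$$ Equivalently, $$\|(I\otimes\Psi_\lambda)(\rho)\|_p\le m_p(0)^{-1}\,m_p(\lambda)\,\|(I\otimes\Psi_0)(\rho)\|_p .$$ -/

import Mathlib

open Matrix
open scoped Kronecker ComplexOrder

noncomputable section

/-- Quantum states: positive semidefinite matrices of trace one. -/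
def IsState {n : Type*} [Fintype n] (ρ : Matrix n n ℂ) : Prop :=
  ρ.PosSemidef ∧ ρ.trace = 1

/-- The Pauli matrices `σ₁, σ₂, σ₃` (indexed by `0, 1, 2`). -/
def pauli : Fin 3 → Matrix (Fin 2) (Fin 2) ℂ :=
  ![!![0, 1; 1, 0], !![0, -Complex.I; Complex.I, 0], !![1, 0; 0, -1]]

/-- The matrix `X ⊗ I + ∑ i, Y i ⊗ σ i` on `ℂ^K ⊗ ℂ^2`. -/
def pauliForm {K : ℕ} (X : Matrix (Fin K) (Fin K) ℂ) (Y : Fin 3 → Matrix (Fin K) (Fin K) ℂ) :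
    Matrix (Fin K × Fin 2) (Fin K × Fin 2) ℂ :=
  X ⊗ₖ (1 : Matrix (Fin 2) (Fin 2) ℂ) + ∑ i, Y i ⊗ₖ pauli i

/-- The phase-damping channel `Ψ_l`: it multiplies the off-diagonal entries by `l`. -/
def phaseDamping (l : ℝ) : Matrix (Fin 2) (Fin 2) ℂ →ₗ[ℂ] Matrix (Fin 2) (Fin 2) ℂ where
  toFun r := !![r 0 0, (l : ℂ) * r 0 1; (l : ℂ) * r 1 0, r 1 1]
  map_add' r s := by
    ext a b; fin_cases a <;> fin_cases b <;> simp [mul_add]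
  map_smul' c r := by
    ext a b; fin_cases a <;> fin_cases b <;> simp [mul_left_comm]

/-- The map `I ⊗ Φ` on matrices over `ℂ^K ⊗ ℂ^2`: for all `i, j`, the map `Φ` is applied to the
2 × 2 matrix of entries with first indices `i, j`. -/
def idTensor (K : ℕ) (Φ : Matrix (Fin 2) (Fin 2) ℂ →ₗ[ℂ] Matrix (Fin 2) (Fin 2) ℂ) :
    Matrix (Fin K × Fin 2) (Fin K × Fin 2) ℂ →ₗ[ℂ] Matrix (Fin K × Fin 2) (Fin K × Fin 2) ℂ where
  toFun ρ := Matrix.of fun x y => Φ (Matrix.of fun a b => ρ (x.1, a) (y.1, b)) x.2 y.2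
  map_add' ρ τ := by
    ext x y
    have h : (Matrix.of fun a b => (ρ + τ) (x.1, a) (y.1, b)) =
        (Matrix.of fun a b => ρ (x.1, a) (y.1, b)) +
          (Matrix.of fun a b => τ (x.1, a) (y.1, b)) := rfl
    simp only [Matrix.of_apply, Matrix.add_apply] at h ⊢
    rw [h, map_add, Matrix.add_apply]
  map_smul' c ρ := by
    ext x y
    have h : (Matrix.of fun a b => (c • ρ) (x.1, a) (y.1, b)) =
        c • (Matrix.of fun a b => ρ (x.1, a) (y.1, b)) := rfl
    simp only [Matrix.of_apply, Matrix.smul_apply, RingHom.id_apply] at h ⊢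
    rw [h, map_smul, Matrix.smul_apply]

/-- `idTensor K Φ` is the tensor product of the identity map with `Φ`. -/
theorem idTensor_kronecker (K : ℕ)
    (Φ : Matrix (Fin 2) (Fin 2) ℂ →ₗ[ℂ] Matrix (Fin 2) (Fin 2) ℂ)
    (A : Matrix (Fin K) (Fin K) ℂ) (B : Matrix (Fin 2) (Fin 2) ℂ) :
    idTensor K Φ (A ⊗ₖ B) = A ⊗ₖ Φ B := by
  ext x y
  have h : (Matrix.of fun a b => (A ⊗ₖ B) (x.1, a) (y.1, b)) = A x.1 y.1 • B := by
    ext a b; simp [Matrix.kroneckerMap_apply]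
  change Φ (Matrix.of fun a b => (A ⊗ₖ B) (x.1, a) (y.1, b)) x.2 y.2 = _
  rw [h, map_smul, Matrix.smul_apply, Matrix.kroneckerMap_apply, smul_eq_mul]

/-- `Tr A^p` for a positive semidefinite matrix `A` and real `p`; the power is taken in the
functional calculus of Hermitian matrices, and the trace is a real number. -/
def trPow {n : Type*} [Fintype n] [DecidableEq n] (p : ℝ) (A : Matrix n n ℂ) : ℝ :=
  (cfc (fun x : ℝ => x ^ p) A).trace.re

/-- The `p`-norm `(Tr A^p)^(1/p)` of a positive semidefinite matrix `A`. -/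
def pNorm {n : Type*} [Fintype n] [DecidableEq n] (p : ℝ) (A : Matrix n n ℂ) : ℝ :=
  trPow p A ^ (1 / p)

/-- `m_p(x) = [((1 + x) / 2)^p + ((1 - x) / 2)^p]^(1/p)`. -/
def mFun (p x : ℝ) : ℝ :=
  (((1 + x) / 2) ^ p + ((1 - x) / 2) ^ p) ^ (1 / p)

end

/-!
The channel `I ⊗ Ψ_l` interpolates between a state `ρ` and its conjugate `G ρ G`, where
`G = I ⊗ σ₃`. Put `D = (ρ + G ρ G) / 2`, the block diagonal part of `ρ`, which is also
`(I ⊗ Ψ_0)(ρ)`. Then `(I ⊗ Ψ_l)(ρ) = D + l (ρ - D) = D^{1/2} M D^{1/2}` with `M = 1 + l T` and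
`T = D^{-1/2} (ρ - D) D^{-1/2}`; the inverse is a pseudo-inverse, which does no harm because
`ρ ≤ 2 D` (`exists_contraction_factor`). The matrix `T` satisfies `-1 ≤ T ≤ 1` and `G T G = -T`.

The Lieb-Thirring inequality `Tr (D^{1/2} M D^{1/2})^p ≤ Tr D^p M^p` (`lieb_thirring`) bounds the
left side by `Tr D^p (1 + l T)^p`. As `G` commutes with `D`, this trace is unchanged when `T` is
replaced by `-T`, so `(1 + l T)^p` may be replaced by its even part in `T`. On `[-1, 1]` the even
part of `t ↦ (1 + l t)^p` is largest at `t = 1` by convexity, which gives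
`Tr ((I ⊗ Ψ_l)(ρ))^p ≤ ((1 + l)^p + (1 - l)^p) / 2 * Tr D^p` (`trPow_dephasing_le`); the theorem is
the `p`-th root of this.

The Lieb-Thirring inequality is obtained from the Hadamard three lines theorem. With
`S = D^{1/2} M D^{1/2}`, the function `z ↦ Tr (D^{pz/2} M^{pz} D^{pz/2} S^{p(1-z)})` is entire and
bounded on the strip `0 ≤ Re z ≤ 1`. On `Re z = 0` it is at most `Tr S^p` in absolute value, on
`Re z = 1` it is at most `Tr D^p M^p`, and at `z = 1/p` it equals `Tr S^p`.
-/

noncomputable section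

variable {n m : Type*} [Fintype n] [DecidableEq n] [Fintype m] [DecidableEq m]

/-! ### Complex-valued functions of a Hermitian matrix -/

/-- `f(A)` for a Hermitian matrix `A` and an arbitrary function `f : ℝ → ℂ`, defined by
diagonalizing `A`. Unlike the continuous functional calculus of self-adjoint elements it admits
complex values, so it provides the complex powers of `A`. -/
def specFun {A : Matrix n n ℂ} (hA : A.IsHermitian) (f : ℝ → ℂ) : Matrix n n ℂ :=
  (hA.eigenvectorUnitary : Matrix n n ℂ) * diagonal (fun i => f (hA.eigenvalues i)) *
    (hA.eigenvectorUnitary : Matrix n n ℂ)ᴴ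

theorem eigenvectorUnitary_conjTranspose_mul {A : Matrix n n ℂ} (hA : A.IsHermitian) :
    (hA.eigenvectorUnitary : Matrix n n ℂ)ᴴ * (hA.eigenvectorUnitary : Matrix n n ℂ) = 1 :=
  Unitary.coe_star_mul_self _

theorem eigenvectorUnitary_mul_conjTranspose {A : Matrix n n ℂ} (hA : A.IsHermitian) :
    (hA.eigenvectorUnitary : Matrix n n ℂ) * (hA.eigenvectorUnitary : Matrix n n ℂ)ᴴ = 1 :=
  Unitary.coe_mul_star_self _

theorem specFun_ofReal {A : Matrix n n ℂ} (hA : A.IsHermitian) :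
    specFun hA (fun x => (x : ℂ)) = A := by
  conv_rhs => rw [hA.spectral_theorem, Unitary.conjStarAlgAut_apply]
  rfl

theorem specFun_one {A : Matrix n n ℂ} (hA : A.IsHermitian) : specFun hA (fun _ => 1) = 1 := by
  simp [specFun, eigenvectorUnitary_mul_conjTranspose]

theorem specFun_mul {A : Matrix n n ℂ} (hA : A.IsHermitian) (f g : ℝ → ℂ) :
    specFun hA f * specFun hA g = specFun hA (fun x => f x * g x) := by
  simp only [specFun]
  calc _ = (hA.eigenvectorUnitary : Matrix n n ℂ) * diagonal (fun i => f (hA.eigenvalues i)) *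
        ((hA.eigenvectorUnitary : Matrix n n ℂ)ᴴ * (hA.eigenvectorUnitary : Matrix n n ℂ)) *
        diagonal (fun i => g (hA.eigenvalues i)) * (hA.eigenvectorUnitary : Matrix n n ℂ)ᴴ := by
        simp only [Matrix.mul_assoc]
    _ = _ := by
        rw [eigenvectorUnitary_conjTranspose_mul, Matrix.mul_one,
          Matrix.mul_assoc _ (diagonal _) (diagonal _), diagonal_mul_diagonal]

theorem specFun_add {A : Matrix n n ℂ} (hA : A.IsHermitian) (f g : ℝ → ℂ) :
    specFun hA f + specFun hA g = specFun hA (fun x => f x + g x) := by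
  simp only [specFun, ← Matrix.add_mul, ← Matrix.mul_add, diagonal_add]

theorem specFun_congr {A : Matrix n n ℂ} (hA : A.IsHermitian) {f g : ℝ → ℂ}
    (h : ∀ i, f (hA.eigenvalues i) = g (hA.eigenvalues i)) : specFun hA f = specFun hA g := by
  simp only [specFun, h]

theorem specFun_conjTranspose {A : Matrix n n ℂ} (hA : A.IsHermitian) (f : ℝ → ℂ) :
    (specFun hA f)ᴴ = specFun hA (fun x => star (f x)) := by
  simp only [specFun, conjTranspose_mul, diagonal_conjTranspose, conjTranspose_conjTranspose,
    Matrix.mul_assoc]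
  rfl

theorem specFun_ofReal_isHermitian {A : Matrix n n ℂ} (hA : A.IsHermitian) (f : ℝ → ℝ) :
    (specFun hA (fun x => (f x : ℂ))).IsHermitian := by
  rw [IsHermitian, specFun_conjTranspose]
  exact specFun_congr _ fun i => Complex.conj_ofReal _

theorem specFun_posSemidef {A : Matrix n n ℂ} (hA : A.IsHermitian) {f : ℝ → ℂ}
    (h : ∀ i, 0 ≤ f (hA.eigenvalues i)) : (specFun hA f).PosSemidef :=
  (PosSemidef.diagonal h).mul_mul_conjTranspose_same _

theorem specFun_sqrt_mul_self {A : Matrix n n ℂ} (hA : A.PosSemidef) :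
    specFun hA.1 (fun x => (√x : ℂ)) * specFun hA.1 (fun x => (√x : ℂ)) = A := by
  conv_rhs => rw [← specFun_ofReal hA.1]
  rw [specFun_mul]
  refine specFun_congr _ fun i => ?_
  rw [← Complex.ofReal_mul, Real.mul_self_sqrt (hA.eigenvalues_nonneg i)]

/-- If `X g(A) = B X`, then `X f(g(A)) = f(B) X`. The matrix `X` may be rectangular, so this covers
commutation, composition of functions and restriction to a block of a block diagonal matrix. -/
theorem specFun_intertwine {A : Matrix n n ℂ} {B : Matrix m m ℂ} (hA : A.IsHermitian)
    (hB : B.IsHermitian) {X : Matrix m n ℂ} (g : ℝ → ℝ)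
    (h : X * specFun hA (fun x => (g x : ℂ)) = B * X) (f : ℝ → ℂ) :
    X * specFun hA (fun x => f (g x)) = specFun hB f * X := by
  set U := (hA.eigenvectorUnitary : Matrix n n ℂ) with hU
  set V := (hB.eigenvectorUnitary : Matrix m m ℂ) with hV
  have hUU : Uᴴ * U = 1 := eigenvectorUnitary_conjTranspose_mul hA
  have hUU' : U * Uᴴ = 1 := eigenvectorUnitary_mul_conjTranspose hA
  have hVV : Vᴴ * V = 1 := eigenvectorUnitary_conjTranspose_mul hB
  have hVV' : V * Vᴴ = 1 := eigenvectorUnitary_mul_conjTranspose hB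
  have key : ∀ (u : n → ℂ) (v : m → ℂ), X * (U * diagonal u * Uᴴ) = (V * diagonal v * Vᴴ) * X ↔
      (Vᴴ * X * U) * diagonal u = diagonal v * (Vᴴ * X * U) := by
    intro u v
    constructor
    · intro e
      calc _ = Vᴴ * (X * (U * diagonal u * Uᴴ)) * U := by
            simp only [Matrix.mul_assoc, hUU, Matrix.mul_one]
        _ = (Vᴴ * V) * diagonal v * Vᴴ * X * U := by rw [e]; simp only [Matrix.mul_assoc]
        _ = _ := by rw [hVV]; simp only [Matrix.mul_assoc, Matrix.one_mul]
    · intro e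
      calc _ = (V * Vᴴ) * X * (U * diagonal u * Uᴴ) := by rw [hVV', Matrix.one_mul]
        _ = V * ((Vᴴ * X * U) * diagonal u) * Uᴴ := by simp only [Matrix.mul_assoc]
        _ = (V * diagonal v * Vᴴ) * X * (U * Uᴴ) := by rw [e]; simp only [Matrix.mul_assoc]
        _ = _ := by rw [hUU', Matrix.mul_one]
  rw [← specFun_ofReal hB] at h
  simp only [specFun, ← hU, ← hV] at h ⊢
  rw [key] at h ⊢
  ext i j
  have hij := congrFun (congrFun h i) j
  simp only [mul_diagonal, diagonal_mul] at hij ⊢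
  -- where the matrix entry is nonzero, the two eigenvalues agree
  by_cases h0 : (Vᴴ * X * U) i j = 0
  · simp [h0]
  · have : (g (hA.eigenvalues j) : ℂ) = (hB.eigenvalues i : ℂ) := by
      rw [mul_comm] at hij; exact mul_right_cancel₀ h0 hij
    rw [Complex.ofReal_inj.mp this, mul_comm]

theorem specFun_intertwine_id {A : Matrix n n ℂ} {B : Matrix m m ℂ} (hA : A.IsHermitian)
    (hB : B.IsHermitian) {X : Matrix m n ℂ} (h : X * A = B * X) (f : ℝ → ℂ) :
    X * specFun hA f = specFun hB f * X :=
  specFun_intertwine hA hB (fun x => x) (by rwa [specFun_ofReal]) f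

theorem specFun_comp {A B : Matrix n n ℂ} (hA : A.IsHermitian) (hB : B.IsHermitian) (g : ℝ → ℝ)
    (h : B = specFun hA (fun x => (g x : ℂ))) (f : ℝ → ℂ) :
    specFun hB f = specFun hA (fun x => f (g x)) := by
  have := specFun_intertwine hA hB (X := 1) g (by rw [← h, Matrix.one_mul, Matrix.mul_one]) f
  rwa [Matrix.one_mul, Matrix.mul_one, eq_comm] at this

theorem trace_mul_specFun {A : Matrix n n ℂ} (hA : A.IsHermitian) (f : ℝ → ℂ)
    (X : Matrix n n ℂ) :
    (X * specFun hA f).trace = ∑ i, ((hA.eigenvectorUnitary : Matrix n n ℂ)ᴴ * X *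
      (hA.eigenvectorUnitary : Matrix n n ℂ)) i i * f (hA.eigenvalues i) := by
  rw [specFun, ← Matrix.mul_assoc, trace_mul_comm, ← Matrix.mul_assoc, ← Matrix.mul_assoc]
  simp only [trace, diag_apply, mul_diagonal]

theorem trace_specFun {A : Matrix n n ℂ} (hA : A.IsHermitian) (f : ℝ → ℂ) :
    (specFun hA f).trace = ∑ i, f (hA.eigenvalues i) := by
  have := trace_mul_specFun hA f 1
  simpa [eigenvectorUnitary_conjTranspose_mul] using this

theorem trPow_eq_specFun {A : Matrix n n ℂ} (hA : A.IsHermitian) (p : ℝ) :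
    trPow p A = (specFun hA (fun x => ((x ^ p : ℝ) : ℂ))).trace.re := by
  rw [trPow, hA.cfc_eq, Matrix.IsHermitian.cfc, Unitary.conjStarAlgAut_apply]
  rfl

theorem trPow_eq_sum {A : Matrix n n ℂ} (hA : A.IsHermitian) (p : ℝ) :
    trPow p A = ∑ i, hA.eigenvalues i ^ p := by
  rw [trPow_eq_specFun hA, trace_specFun, ← Complex.ofReal_sum, Complex.ofReal_re]

theorem trPow_nonneg {A : Matrix n n ℂ} (hA : A.PosSemidef) (p : ℝ) : 0 ≤ trPow p A := by
  rw [trPow_eq_sum hA.1]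
  exact Finset.sum_nonneg fun i _ => Real.rpow_nonneg (hA.eigenvalues_nonneg i) p

/-! ### Bounds in the operator norm -/

section Norm
open scoped Matrix.Norms.L2Operator

theorem l2_opNorm_specFun_le {A : Matrix n n ℂ} (hA : A.IsHermitian) {f : ℝ → ℂ} {C : ℝ}
    (hC : 0 ≤ C) (h : ∀ i, ‖f (hA.eigenvalues i)‖ ≤ C) : ‖specFun hA f‖ ≤ C := by
  have hU := CStarRing.norm_mul_coe_unitary
    ((hA.eigenvectorUnitary : Matrix n n ℂ) * diagonal (fun i => f (hA.eigenvalues i)))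
    (star hA.eigenvectorUnitary)
  have hU' := CStarRing.norm_coe_unitary_mul hA.eigenvectorUnitary
    (diagonal (fun i => f (hA.eigenvalues i)))
  rw [hU', l2_opNorm_diagonal] at hU
  change ‖_ * star _‖ ≤ C
  exact hU.trans_le ((pi_norm_le_iff_of_nonneg hC).2 h)

/-- If the `i`-th columns `x` of `P` and `y` of `Q` have the same length, then `|x* W y| ≤ ‖x‖ ^ 2`
for a contraction `W`. -/
theorem norm_conjTranspose_mul_mul_apply_le (P W Q : Matrix n n ℂ) (hW : ‖W‖ ≤ 1) (i : n)
    (h : (Qᴴ * Q) i i = (Pᴴ * P) i i) :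
    ‖(Pᴴ * W * Q) i i‖ ≤ ((Pᴴ * P) i i).re := by
  have hone : ∀ A : Matrix Unit Unit ℂ, ‖A‖ = ‖A () ()‖ := by
    intro A
    have : A = diagonal (fun _ => A () ()) := by ext; simp
    conv_lhs => rw [this, l2_opNorm_diagonal]
    exact pi_norm_const _
  -- the `i`-th column, as a matrix with one column
  let c (R : Matrix n n ℂ) : Matrix n Unit ℂ := R.submatrix id fun _ => i
  have hc : ∀ R, ‖c R‖ * ‖c R‖ = ((Rᴴ * R) i i).re := by
    intro R
    rw [← l2_opNorm_conjTranspose_mul_self, hone]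
    have h0 : 0 ≤ (Rᴴ * R) i i := (posSemidef_conjTranspose_mul_self R).diag_nonneg
    exact congrArg Complex.re (Complex.norm_of_nonneg' h0)
  have hPQ : ‖c Q‖ = ‖c P‖ := by
    have := (hc Q).trans ((congrArg Complex.re h).trans (hc P).symm)
    exact (mul_self_inj (norm_nonneg _) (norm_nonneg _)).1 this
  calc ‖(Pᴴ * W * Q) i i‖ = ‖(c P)ᴴ * W * c Q‖ := by rw [hone]; rfl
    _ ≤ ‖(c P)ᴴ * W‖ * ‖c Q‖ := l2_opNorm_mul _ _
    _ ≤ ‖(c P)ᴴ‖ * ‖W‖ * ‖c Q‖ := by gcongr; exact l2_opNorm_mul _ _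
    _ ≤ ‖(c P)ᴴ‖ * 1 * ‖c Q‖ := by gcongr
    _ = _ := by rw [l2_opNorm_conjTranspose, mul_one, hPQ, hc]

end Norm

/-! ### Complex powers -/

/-- The complex power `x ^ z` of a real number `x ≥ 0`, with `0 ^ z = 0` for every `z`, also for
`z = 0`. This convention makes `z ↦ x ^ z` entire and multiplicative at `x = 0` too. -/
def powZ (z : ℂ) (x : ℝ) : ℂ := if x = 0 then 0 else Complex.exp (z * Real.log x)

theorem powZ_mul (z w : ℂ) (x : ℝ) : powZ z x * powZ w x = powZ (z + w) x := by
  unfold powZ; split_ifs <;> simp [add_mul, Complex.exp_add]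

theorem star_powZ (z : ℂ) (x : ℝ) : star (powZ z x) = powZ (star z) x := by
  unfold powZ; split_ifs
  · simp
  · simp [← Complex.exp_conj]

theorem powZ_ofReal {r x : ℝ} (hr : r ≠ 0) (hx : 0 ≤ x) : powZ r x = ((x ^ r : ℝ) : ℂ) := by
  unfold powZ; split_ifs with h
  · simp [h, Real.zero_rpow hr]
  · rw [Real.rpow_def_of_pos (lt_of_le_of_ne hx (Ne.symm h))]; push_cast; rw [mul_comm]

theorem norm_powZ_le {z : ℂ} {x : ℝ} (hx : 0 ≤ x) : ‖powZ z x‖ ≤ x ^ z.re := by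
  unfold powZ; split_ifs with h
  · simpa using Real.rpow_nonneg hx _
  · rw [Real.rpow_def_of_pos (lt_of_le_of_ne hx (Ne.symm h)), Complex.norm_exp]
    simp [mul_comm]

/-- The entire functions that are bounded on the strip `0 ≤ Re z ≤ 1`. -/
def BddEntire (f : ℂ → ℂ) : Prop :=
  Differentiable ℂ f ∧
    ∃ C, ∀ z ∈ Complex.HadamardThreeLines.verticalClosedStrip 0 1, ‖f z‖ ≤ C

namespace BddEntire

theorem const (c : ℂ) : BddEntire fun _ => c :=
  ⟨differentiable_const c, ‖c‖, fun _ _ => le_rfl⟩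

theorem mul {f g : ℂ → ℂ} (hf : BddEntire f) (hg : BddEntire g) :
    BddEntire fun z => f z * g z := by
  obtain ⟨hf, C, hC⟩ := hf
  obtain ⟨hg, E, hE⟩ := hg
  refine ⟨hf.mul hg, C * E, fun z hz => ?_⟩
  rw [norm_mul]
  exact mul_le_mul (hC z hz) (hE z hz) (norm_nonneg _) ((norm_nonneg _).trans (hC z hz))

theorem sum {ι : Type*} (s : Finset ι) {f : ι → ℂ → ℂ} (h : ∀ i ∈ s, BddEntire (f i)) :
    BddEntire fun z => ∑ i ∈ s, f i z := by
  refine ⟨Differentiable.fun_sum fun i hi => (h i hi).1, ?_⟩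
  choose! C hC using fun i hi => (h i hi).2
  exact ⟨∑ i ∈ s, C i, fun z hz =>
    (norm_sum_le _ _).trans (Finset.sum_le_sum fun i hi => hC i hi z hz)⟩

theorem powZ_affine (a b x : ℝ) : BddEntire fun z => powZ (a * z + b) x := by
  unfold powZ
  split_ifs
  · exact const 0
  · refine ⟨by fun_prop, Real.exp ((|a| + |b|) * |Real.log x|), fun z hz => ?_⟩
    have hz : 0 ≤ z.re ∧ z.re ≤ 1 := hz
    rw [Complex.norm_exp, Real.exp_le_exp]
    have : ((a * z + b) * (Real.log x : ℂ)).re = (a * z.re + b) * Real.log x := by simp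
    rw [this]
    refine (le_abs_self _).trans ?_
    rw [abs_mul]
    refine mul_le_mul_of_nonneg_right ((abs_add_le _ _).trans ?_) (abs_nonneg _)
    rw [abs_mul, abs_of_nonneg hz.1]
    exact add_le_add_left (mul_le_of_le_one_right (abs_nonneg _) hz.2) _

end BddEntire

/-- The matrix-valued functions all of whose entries are entire and bounded on the strip
`0 ≤ Re z ≤ 1`. -/
def BddEntireMat {ι : Type*} (F : ℂ → Matrix ι ι ℂ) : Prop := ∀ i j, BddEntire fun z => F z i j

theorem BddEntireMat.mul {ι : Type*} [Fintype ι] {F G : ℂ → Matrix ι ι ℂ}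
    (hF : BddEntireMat F) (hG : BddEntireMat G) :
    BddEntireMat fun z => F z * G z := fun i j => by
  simp only [Matrix.mul_apply]
  exact BddEntire.sum _ fun k _ => (hF i k).mul (hG k j)

theorem BddEntireMat.trace {ι : Type*} [Fintype ι] {F : ℂ → Matrix ι ι ℂ} (hF : BddEntireMat F) :
    BddEntire fun z => (F z).trace :=
  BddEntire.sum _ fun i _ => hF i i

theorem bddEntireMat_specFun {A : Matrix n n ℂ} (hA : A.IsHermitian) (a b : ℝ) :
    BddEntireMat fun z => specFun hA (powZ (a * z + b)) := by
  refine BddEntireMat.mul (BddEntireMat.mul (fun i j => .const _) fun i j => ?_)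
    fun i j => .const _
  simp only [diagonal_apply]
  split_ifs
  · exact BddEntire.powZ_affine a b _
  · exact .const 0

/-- The Hadamard three lines theorem on the real segment of the strip `0 ≤ Re z ≤ 1`. -/
theorem BddEntire.norm_le_interp {f : ℂ → ℂ} (hf : BddEntire f) {a b t : ℝ}
    (ht : t ∈ Set.Icc (0 : ℝ) 1) (ha : ∀ z : ℂ, z.re = 0 → ‖f z‖ ≤ a)
    (hb : ∀ z : ℂ, z.re = 1 → ‖f z‖ ≤ b) : ‖f t‖ ≤ a ^ (1 - t) * b ^ t := by
  obtain ⟨hd, C, hC⟩ := hf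
  have := Complex.HadamardThreeLines.norm_le_interp_of_mem_verticalClosedStrip' (f := f)
    (z := (t : ℂ)) (a := a) (b := b) zero_lt_one
    (by simpa [Complex.HadamardThreeLines.verticalClosedStrip] using ht)
    hd.diffContOnCl ⟨C, by rintro _ ⟨z, hz, rfl⟩; exact hC z hz⟩ ha hb
  simpa using this

/-! ### The Lieb-Thirring inequality -/

section LiebThirring
open scoped Matrix.Norms.L2Operator

/-- The estimate on the line `Re z = 1`: in an eigenbasis `u i` of `M`, the trace is the sum of
`⟪u i, D^w W D^w u i⟫ m i ^ v`, and the normal matrix `D^w` satisfies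
`(D^w)* D^w = D^w (D^w)* = D^p`. -/
theorem norm_trace_mul_specFun_powZ_le_of_re_eq {D M : Matrix n n ℂ} (hD : D.PosSemidef)
    (hM : M.PosSemidef) {p : ℝ} (hp : p ≠ 0) {W : Matrix n n ℂ} (hW : ‖W‖ ≤ 1) {w v : ℂ} (hw : w.re = p / 2)
    (hv : v.re = p) :
    ‖((specFun hD.1 (powZ w) * W * specFun hD.1 (powZ w)) * specFun hM.1 (powZ v)).trace‖ ≤
      (specFun hD.1 (fun x => ((x ^ p : ℝ) : ℂ)) *
        specFun hM.1 (fun x => ((x ^ p : ℝ) : ℂ))).trace.re := by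
  set U := (hM.1.eigenvectorUnitary : Matrix n n ℂ) with hU
  have hsum : w + star w = (p : ℂ) := by
    rw [Complex.star_def, Complex.add_conj, hw]; push_cast; ring
  have hDD : (specFun hD.1 (powZ w))ᴴ * specFun hD.1 (powZ w) =
      specFun hD.1 (fun x => ((x ^ p : ℝ) : ℂ)) := by
    rw [specFun_conjTranspose, specFun_mul]
    refine specFun_congr _ fun i => ?_
    rw [star_powZ, powZ_mul, add_comm, hsum, powZ_ofReal hp (hD.eigenvalues_nonneg i)]
  have hDD' : specFun hD.1 (powZ w) * (specFun hD.1 (powZ w))ᴴ =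
      specFun hD.1 (fun x => ((x ^ p : ℝ) : ℂ)) := by
    rw [specFun_conjTranspose, specFun_mul]
    refine specFun_congr _ fun i => ?_
    rw [star_powZ, powZ_mul, hsum, powZ_ofReal hp (hD.eigenvalues_nonneg i)]
  rw [trace_mul_specFun, trace_mul_specFun, Complex.re_sum]
  refine (norm_sum_le _ _).trans (Finset.sum_le_sum fun i _ => ?_)
  rw [norm_mul, Complex.re_mul_ofReal]
  refine mul_le_mul ?_ ((norm_powZ_le (hM.eigenvalues_nonneg i)).trans_eq (by rw [hv]))
    (norm_nonneg _) ?_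
  · have := norm_conjTranspose_mul_mul_apply_le ((specFun hD.1 (powZ w))ᴴ * U) W
      (specFun hD.1 (powZ w) * U) hW i ?_
    · simpa only [conjTranspose_mul, conjTranspose_conjTranspose, ← hDD', Matrix.mul_assoc]
        using this
    · have e1 : (specFun hD.1 (powZ w) * U)ᴴ * (specFun hD.1 (powZ w) * U) =
          Uᴴ * ((specFun hD.1 (powZ w))ᴴ * specFun hD.1 (powZ w)) * U := by
        simp only [conjTranspose_mul, Matrix.mul_assoc]
      have e2 : ((specFun hD.1 (powZ w))ᴴ * U)ᴴ * ((specFun hD.1 (powZ w))ᴴ * U) =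
          Uᴴ * (specFun hD.1 (powZ w) * (specFun hD.1 (powZ w))ᴴ) * U := by
        simp only [conjTranspose_mul, Matrix.mul_assoc, conjTranspose_conjTranspose]
      rw [e1, e2, hDD, hDD']
  · rw [← hDD]
    have : Uᴴ * ((specFun hD.1 (powZ w))ᴴ * specFun hD.1 (powZ w)) * U =
        (specFun hD.1 (powZ w) * U)ᴴ * (specFun hD.1 (powZ w) * U) := by
      simp only [conjTranspose_mul, Matrix.mul_assoc]
    rw [this]
    exact (Complex.le_def.1 (posSemidef_conjTranspose_mul_self _).diag_nonneg).1

/-- The estimate on the line `Re z = 0`. -/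
theorem norm_trace_mul_specFun_powZ_le {S : Matrix n n ℂ} (hS : S.PosSemidef) {p : ℝ}
    {W : Matrix n n ℂ} (hW : ‖W‖ ≤ 1) {w : ℂ} (hw : w.re = p) :
    ‖(W * specFun hS.1 (powZ w)).trace‖ ≤ trPow p S := by
  rw [trace_mul_specFun, trPow_eq_sum hS.1]
  refine (norm_sum_le _ _).trans (Finset.sum_le_sum fun i _ => ?_)
  rw [norm_mul]
  have h1 := norm_conjTranspose_mul_mul_apply_le (hS.1.eigenvectorUnitary : Matrix n n ℂ) W
    (hS.1.eigenvectorUnitary : Matrix n n ℂ) hW i rfl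
  rw [eigenvectorUnitary_conjTranspose_mul, one_apply_eq, Complex.one_re] at h1
  have h2 := norm_powZ_le (z := w) (hS.eigenvalues_nonneg i)
  rw [hw] at h2
  exact (mul_le_mul h1 h2 (norm_nonneg _) zero_le_one).trans_eq (one_mul _)

theorem l2_opNorm_specFun_powZ_le_one {A : Matrix n n ℂ} (hA : A.PosSemidef) {z : ℂ}
    (hz : z.re = 0) : ‖specFun hA.1 (powZ z)‖ ≤ 1 :=
  l2_opNorm_specFun_le _ zero_le_one fun i =>
    (norm_powZ_le (hA.eigenvalues_nonneg i)).trans_eq (by rw [hz, Real.rpow_zero])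

/-- The **Lieb-Thirring inequality** `Tr (D^{1/2} M D^{1/2})^p ≤ Tr D^p M^p` for positive
semidefinite `D`, `M` and real `p ≥ 1`. -/
theorem lieb_thirring {D M S : Matrix n n ℂ} (hD : D.PosSemidef) (hM : M.PosSemidef)
    (hS : S.PosSemidef)
    (hSDM : S = specFun hD.1 (fun x => (√x : ℂ)) * M * specFun hD.1 (fun x => (√x : ℂ)))
    {p : ℝ} (hp : 1 ≤ p) :
    trPow p S ≤ (specFun hD.1 (fun x => ((x ^ p : ℝ) : ℂ)) *
      specFun hM.1 (fun x => ((x ^ p : ℝ) : ℂ))).trace.re := by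
  set L := (specFun hD.1 (fun x => ((x ^ p : ℝ) : ℂ)) *
      specFun hM.1 (fun x => ((x ^ p : ℝ) : ℂ))).trace.re with hL
  have hp0 : 0 < p := by linarith
  have hpC : (p : ℂ) ≠ 0 := by exact_mod_cast hp0.ne'
  let d (z : ℂ) : Matrix n n ℂ := specFun hD.1 (powZ ((p / 2 : ℝ) * z + (0 : ℝ)))
  let e (z : ℂ) : Matrix n n ℂ := specFun hM.1 (powZ ((p : ℝ) * z + (0 : ℝ)))
  let s (z : ℂ) : Matrix n n ℂ := specFun hS.1 (powZ ((-p : ℝ) * z + (p : ℝ)))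
  have hF : BddEntire fun z => (d z * e z * d z * s z).trace :=
    ((((bddEntireMat_specFun hD.1 _ _).mul (bddEntireMat_specFun hM.1 _ _)).mul
      (bddEntireMat_specFun hD.1 _ _)).mul (bddEntireMat_specFun hS.1 _ _)).trace
  have h0 : ∀ z : ℂ, z.re = 0 → ‖(d z * e z * d z * s z).trace‖ ≤ trPow p S := by
    intro z hz
    refine norm_trace_mul_specFun_powZ_le hS ?_ (by simp [hz])
    have hd : ‖d z‖ ≤ 1 := l2_opNorm_specFun_powZ_le_one hD (by simp [hz])
    have he : ‖e z‖ ≤ 1 := l2_opNorm_specFun_powZ_le_one hM (by simp [hz])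
    calc ‖d z * e z * d z‖ ≤ ‖d z‖ * ‖e z‖ * ‖d z‖ := norm_mul₃_le
      _ ≤ 1 * 1 * 1 := by gcongr
      _ = 1 := by norm_num
  have h1 : ∀ z : ℂ, z.re = 1 → ‖(d z * e z * d z * s z).trace‖ ≤ L := by
    intro z hz
    have : (d z * e z * d z * s z).trace = ((d z * s z * d z) * e z).trace := by
      rw [Matrix.mul_assoc (d z * e z), trace_mul_comm, ← Matrix.mul_assoc]
    rw [this]
    exact norm_trace_mul_specFun_powZ_le_of_re_eq hD hM hp0.ne'
      (l2_opNorm_specFun_powZ_le_one hS (by simp [hz])) (by simp [hz]) (by simp [hz])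
  have hL0 : 0 ≤ L := (norm_nonneg _).trans (h1 1 rfl)
  have hmid : (d (p⁻¹ : ℝ) * e (p⁻¹ : ℝ) * d (p⁻¹ : ℝ) * s (p⁻¹ : ℝ)).trace = trPow p S := by
    have hd : d (p⁻¹ : ℝ) = specFun hD.1 (fun x => (√x : ℂ)) := by
      refine specFun_congr _ fun i => ?_
      have : ((p / 2 : ℝ) : ℂ) * ((p⁻¹ : ℝ) : ℂ) + (0 : ℝ) = ((1 / 2 : ℝ) : ℂ) := by
        push_cast; field_simp; simp
      rw [this, powZ_ofReal (by norm_num) (hD.eigenvalues_nonneg i), Real.sqrt_eq_rpow]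
    have he : e (p⁻¹ : ℝ) = M := by
      conv_rhs => rw [← specFun_ofReal hM.1]
      refine specFun_congr _ fun i => ?_
      have : (p : ℂ) * ((p⁻¹ : ℝ) : ℂ) + (0 : ℝ) = ((1 : ℝ) : ℂ) := by
        push_cast; field_simp; simp
      rw [this, powZ_ofReal one_ne_zero (hM.eigenvalues_nonneg i), Real.rpow_one]
    have hs : S * s (p⁻¹ : ℝ) = specFun hS.1 (fun x => ((x ^ p : ℝ) : ℂ)) := by
      conv_lhs => rw [← specFun_ofReal hS.1, specFun_mul]
      refine specFun_congr _ fun i => ?_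
      have h1 : (hS.1.eigenvalues i : ℂ) = powZ (1 : ℝ) (hS.1.eigenvalues i) := by
        rw [powZ_ofReal one_ne_zero (hS.eigenvalues_nonneg i), Real.rpow_one]
      have h2 : ((1 : ℝ) : ℂ) + (((-p : ℝ) : ℂ) * ((p⁻¹ : ℝ) : ℂ) + (p : ℝ)) = (p : ℝ) := by
        push_cast; field_simp; ring
      rw [h1, powZ_mul, h2, powZ_ofReal hp0.ne' (hS.eigenvalues_nonneg i)]
    rw [hd, he, ← hSDM, hs, trPow_eq_sum hS.1, trace_specFun]
    push_cast; rfl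
  -- the interpolated bound `N ≤ N ^ (1 - 1 / p) * L ^ (1 / p)` for `N = Tr S^p`
  have key := hF.norm_le_interp (t := p⁻¹) ⟨by positivity, inv_le_one_of_one_le₀ hp⟩ h0 h1
  simp only [hmid] at key
  rw [Complex.norm_of_nonneg (trPow_nonneg hS p)] at key
  rcases (trPow_nonneg hS p).eq_or_lt with hN | hN
  · rw [← hN]; exact hL0
  · have hN' := Real.rpow_pos_of_pos hN (1 - p⁻¹)
    have hsplit : trPow p S = trPow p S ^ (1 - p⁻¹) * trPow p S ^ p⁻¹ := by
      rw [← Real.rpow_add hN]; simp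
    have : trPow p S ^ p⁻¹ ≤ L ^ p⁻¹ := by
      refine le_of_mul_le_mul_left ?_ hN'
      calc _ = trPow p S := hsplit.symm
        _ ≤ _ := key
    exact (Real.rpow_le_rpow_iff hN.le hL0 (by positivity)).1 this

end LiebThirring

/-! ### The dephasing inequality -/

/-- The even part of the convex function `t ↦ (1 + l t) ^ p` on `[-1, 1]` is largest at `t = 1`. -/
theorem half_sum_rpow_le {p l t : ℝ} (hp : 1 ≤ p) (hl : l ∈ Set.Icc (-1 : ℝ) 1)
    (ht : t ∈ Set.Icc (-1 : ℝ) 1) :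
    (1 + l * t) ^ p + (1 - l * t) ^ p ≤ (1 + l) ^ p + (1 - l) ^ p := by
  obtain ⟨hl1, hl2⟩ := hl
  obtain ⟨ht1, ht2⟩ := ht
  have hp1 : 1 + l ∈ Set.Ici (0 : ℝ) := Set.mem_Ici.2 (by linarith)
  have hp2 : 1 - l ∈ Set.Ici (0 : ℝ) := Set.mem_Ici.2 (by linarith)
  have ha : 0 ≤ (1 + t) / 2 := by linarith
  have hb : 0 ≤ (1 - t) / 2 := by linarith
  have h1 := (convexOn_rpow hp).2 hp1 hp2 ha hb (by ring)
  have h2 := (convexOn_rpow hp).2 hp1 hp2 hb ha (by ring)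
  simp only [smul_eq_mul] at h1 h2
  rw [show (1 + t) / 2 * (1 + l) + (1 - t) / 2 * (1 - l) = 1 + l * t by ring] at h1
  rw [show (1 - t) / 2 * (1 + l) + (1 + t) / 2 * (1 - l) = 1 - l * t by ring] at h2
  linarith

theorem mul_eq_zero_of_conj_eq_zero {R Q : Matrix n n ℂ} (hR : R.PosSemidef)
    (h : Qᴴ * R * Q = 0) : R * Q = 0 := by
  set W := specFun hR.1 (fun x => (√x : ℂ)) with hW
  have hWH : Wᴴ = W := specFun_ofReal_isHermitian hR.1 _
  have hWW : W * W = R := specFun_sqrt_mul_self hR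
  have : (W * Q)ᴴ * (W * Q) = 0 := by
    rw [conjTranspose_mul, hWH, ← h, ← hWW]; simp only [Matrix.mul_assoc]
  rw [← hWW, Matrix.mul_assoc, conjTranspose_mul_self_eq_zero.1 this, Matrix.mul_zero]

/-- If `2 D = R + R'` with positive semidefinite `R`, `R'`, then `D + l (R - D)` factors as
`D^{1/2} (1 + l T) D^{1/2}`, where `1 + l T ≥ 0` for all `l ∈ [-1, 1]`. Here `T = k (R - D) k` with
`k = f(D)`, which records that `T` inherits the symmetries of `R - D` and `D`. -/
theorem exists_contraction_factor {R R' D : Matrix n n ℂ} (hR : R.PosSemidef)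
    (hR' : R'.PosSemidef) (hD : D.PosSemidef) (hsum : D + D = R + R') :
    ∃ f : ℝ → ℝ, let k := specFun hD.1 (fun x => (f x : ℂ)); let T := k * (R - D) * k
      (∀ l ∈ Set.Icc (-1 : ℝ) 1, (1 + (l : ℂ) • T).PosSemidef) ∧
      ∀ l : ℝ, D + (l : ℂ) • (R - D) = specFun hD.1 (fun x => (√x : ℂ)) * (1 + (l : ℂ) • T) *
        specFun hD.1 (fun x => (√x : ℂ)) := by
  -- as `(√0)⁻¹ = 0`, this gives the pseudo-inverse of the square root of `D`
  refine ⟨fun x => (√x)⁻¹, ?_⟩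
  intro k T
  set h := specFun hD.1 (fun x => (√x : ℂ)) with hh
  set P := specFun hD.1 (fun x => if x = 0 then 0 else 1) with hP
  set Q := specFun hD.1 (fun x => if x = 0 then 1 else 0) with hQ
  have sq0 (i) (hi : hD.1.eigenvalues i ≠ 0) : ((√(hD.1.eigenvalues i) : ℝ) : ℂ) ≠ 0 := by
    rw [Complex.ofReal_ne_zero]
    exact (Real.sqrt_pos.2 (lt_of_le_of_ne (hD.eigenvalues_nonneg i) hi.symm)).ne'
  have hhk : h * k = P := by
    rw [hh, specFun_mul]
    refine specFun_congr _ fun i => ?_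
    split_ifs with hi
    · simp [hi]
    · push_cast; exact mul_inv_cancel₀ (sq0 i hi)
  have hkh : k * h = P := by
    rw [← hhk, hh, specFun_mul, specFun_mul]
    simp only [mul_comm]
  have hhh : h * h = D := specFun_sqrt_mul_self hD
  have hPQ : P + Q = 1 := by
    rw [hP, specFun_add, ← specFun_one hD.1]
    refine specFun_congr _ fun i => ?_
    split_ifs <;> simp
  have hQD : Q * D = 0 := by
    conv_lhs => rw [← specFun_ofReal hD.1, hQ, specFun_mul]
    have : specFun hD.1 (fun _ => 0) = 0 := by simp [specFun]
    rw [← this]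
    refine specFun_congr _ fun i => ?_
    split_ifs with hi <;> simp [hi]
  have hkH : kᴴ = k := specFun_ofReal_isHermitian hD.1 _
  have hQpos : Q.PosSemidef := specFun_posSemidef _ fun i => by split_ifs <;> simp
  have hQH : Qᴴ = Q := hQpos.1
  -- `R ≤ 2 D`, so the kernel of `D` is contained in that of `R`
  have hRQ : R * Q = 0 := by
    refine mul_eq_zero_of_conj_eq_zero hR ?_
    have a := (hR.conjTranspose_mul_mul_same Q)
    have b := (hR'.conjTranspose_mul_mul_same Q)
    have c : Qᴴ * R * Q + Qᴴ * R' * Q = 0 := by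
      rw [← Matrix.add_mul, ← Matrix.mul_add, ← hsum, Matrix.mul_add, hQH, hQD]; simp
    have ct : (Qᴴ * R * Q).trace + (Qᴴ * R' * Q).trace = 0 := by rw [← trace_add, c, trace_zero]
    exact a.trace_eq_zero_iff.1 ((add_eq_zero_iff_of_nonneg a.trace_nonneg b.trace_nonneg).1 ct).1
  have hQR : Q * R = 0 := by
    have := congrArg conjTranspose hRQ
    rwa [conjTranspose_mul, hQH, hR.1.eq, conjTranspose_zero] at this
  have hDQ : D * Q = 0 := by
    have := congrArg conjTranspose hQD
    rwa [conjTranspose_mul, hQH, hD.1.eq, conjTranspose_zero] at this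
  have hkDk : k * D * k = P := by
    rw [← hhh, ← Matrix.mul_assoc, hkh, Matrix.mul_assoc, hhk, hP, specFun_mul]
    refine specFun_congr _ fun i => ?_
    split_ifs <;> simp
  have hPl : P = 1 - Q := eq_sub_of_add_eq hPQ
  refine ⟨fun l hl => ?_, fun l => ?_⟩
  · -- `1 + l T` is the projection `Q` plus a convex combination of `k R k` and `k R' k`
    have : 1 + (l : ℂ) • T = Q + ((((1 + l) / 2 : ℝ) : ℂ) • (kᴴ * R * k) +
        (((1 - l) / 2 : ℝ) : ℂ) • (kᴴ * R' * k)) := by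
      have hD2 : k * D * k + k * D * k = k * R * k + k * R' * k := by
        have : k * (D + D) * k = k * (R + R') * k := by rw [hsum]
        simpa only [Matrix.mul_add, Matrix.add_mul] using this
      have hR'' : k * R' * k = P + P - k * R * k := by
        rw [← hkDk, hD2]; abel
      rw [hkH, hR'', ← hPQ]
      have : T = k * R * k - P := by
        rw [← hkDk, ← Matrix.sub_mul, ← Matrix.mul_sub]
      rw [this]
      push_cast
      module
    rw [this]
    refine hQpos.add (((hR.conjTranspose_mul_mul_same k).smul ?_).add
      ((hR'.conjTranspose_mul_mul_same k).smul ?_))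
    · exact_mod_cast (by linarith [hl.1] : 0 ≤ (1 + l) / 2)
    · exact_mod_cast (by linarith [hl.2] : 0 ≤ (1 - l) / 2)
  · have : h * T * h = R - D := by
      calc h * T * h = (h * k) * (R - D) * (k * h) := by simp only [T, Matrix.mul_assoc]
        _ = _ := by
          rw [hhk, hkh, hPl]
          simp only [Matrix.sub_mul, Matrix.mul_sub, hQR, hQD, hRQ, hDQ, Matrix.one_mul,
            Matrix.mul_one, sub_zero]
    rw [Matrix.mul_add, Matrix.add_mul, Matrix.mul_one, hhh, Matrix.mul_smul, Matrix.smul_mul,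
      this]

/-- The dephasing inequality for a symmetry `G`: here `D` is the part of `R` that commutes with `G`
and `R - D` the part that anticommutes with it, which is multiplied by `l`. -/
theorem trPow_dephasing_le {R D G : Matrix n n ℂ} (hR : R.PosSemidef) (hG : Gᴴ = G)
    (hGG : G * G = 1) (hD : D.PosSemidef) (hsum : D + D = R + G * R * G) {l p : ℝ}
    (hl : l ∈ Set.Icc (-1 : ℝ) 1) (hp : 1 ≤ p) (hS : (D + (l : ℂ) • (R - D)).PosSemidef) :
    trPow p (D + (l : ℂ) • (R - D)) ≤ ((1 + l) ^ p + (1 - l) ^ p) / 2 * trPow p D := by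
  have hR' : (G * R * G).PosSemidef := by
    have := hR.conjTranspose_mul_mul_same G
    rwa [hG] at this
  obtain ⟨f, hpos, hfac⟩ := exists_contraction_factor hR hR' hD hsum
  set k := specFun hD.1 (fun x => (f x : ℂ)) with hk
  set T := k * (R - D) * k with hT
  have hkH : kᴴ = k := specFun_ofReal_isHermitian hD.1 _
  have hTH : T.IsHermitian := by
    rw [IsHermitian, hT, conjTranspose_mul, conjTranspose_mul, hkH, conjTranspose_sub,
      hR.1.eq, hD.1.eq, Matrix.mul_assoc]
  have hDG : G * D = D * G := by
    have h2 : G * (D + D) = (D + D) * G := by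
      rw [hsum, Matrix.mul_add, Matrix.add_mul, Matrix.mul_assoc (G * R), hGG, Matrix.mul_one,
        ← Matrix.mul_assoc, ← Matrix.mul_assoc, hGG, Matrix.one_mul, add_comm]
    rw [← two_smul ℂ D, Matrix.mul_smul, Matrix.smul_mul] at h2
    exact smul_right_injective _ (two_ne_zero (α := ℂ)) h2
  have hGT : G * T = -T * G := by
    have hGk : G * k = k * G := specFun_intertwine_id hD.1 hD.1 hDG _
    have hx : G * (R - D) = -(R - D) * G := by
      have : G * R = (D + D - R) * G := by
        rw [hsum, add_sub_cancel_left, Matrix.mul_assoc, hGG, Matrix.mul_one]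
      rw [Matrix.mul_sub, this, hDG, ← Matrix.sub_mul]
      congr 1; abel
    calc G * T = (G * k) * (R - D) * k := by simp only [hT, Matrix.mul_assoc]
      _ = k * (G * (R - D)) * k := by rw [hGk]; simp only [Matrix.mul_assoc]
      _ = k * -(R - D) * (G * k) := by rw [hx]; simp only [Matrix.mul_assoc]
      _ = _ := by
        rw [hGk, hT]
        simp only [Matrix.mul_neg, Matrix.neg_mul, Matrix.mul_assoc]
  have hM := hpos l hl
  have hM' := hpos (-l) ⟨by linarith [hl.2], by linarith [hl.1]⟩
  have hspec (r : ℝ) : 1 + (r : ℂ) • T = specFun hTH (fun x => ((1 + r * x : ℝ) : ℂ)) := by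
    have : (r : ℂ) • T = specFun hTH (fun x => ((r : ℂ) * x)) := by
      conv_lhs => rw [← specFun_ofReal hTH]
      rw [specFun, ← Matrix.smul_mul, ← Matrix.mul_smul, ← diagonal_smul]; rfl
    rw [this, ← specFun_one hTH, specFun_add]
    push_cast; rfl
  have hτ (r : ℝ) (hr : r ∈ Set.Icc (-1 : ℝ) 1) (i : n) : 0 ≤ 1 + r * hTH.eigenvalues i := by
    have h1 := ((hpos r hr).conjTranspose_mul_mul_same
      (hTH.eigenvectorUnitary : Matrix n n ℂ)).diag_nonneg (i := i)
    have h2 : (hTH.eigenvectorUnitary : Matrix n n ℂ)ᴴ * (1 + (r : ℂ) • T) *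
        (hTH.eigenvectorUnitary : Matrix n n ℂ) =
          diagonal fun i => ((1 + r * hTH.eigenvalues i : ℝ) : ℂ) := by
      rw [hspec, specFun, Matrix.mul_assoc, Matrix.mul_assoc,
        eigenvectorUnitary_conjTranspose_mul, Matrix.mul_one, ← Matrix.mul_assoc,
        eigenvectorUnitary_conjTranspose_mul, Matrix.one_mul]
    rw [h2, diagonal_apply_eq] at h1
    exact_mod_cast h1
  refine (lieb_thirring hD hM hS (hfac l) hp).trans ?_
  set Dp := specFun hD.1 (fun x => ((x ^ p : ℝ) : ℂ)) with hDp
  set φ : ℝ → ℂ := fun x => ((x ^ p : ℝ) : ℂ)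
  -- conjugation by `G` fixes `D` and exchanges `1 + l T` with `1 - l T`
  have hflip : (Dp * specFun hM.1 φ).trace = (Dp * specFun hM'.1 φ).trace := by
    have h1 : G * specFun hM.1 φ = specFun hM'.1 φ * G := by
      refine specFun_intertwine_id _ _ ?_ _
      rw [Matrix.mul_add, Matrix.add_mul, Matrix.mul_one, Matrix.one_mul, Matrix.mul_smul, hGT,
        Matrix.smul_mul]
      simp
    have h2 : G * Dp = Dp * G := specFun_intertwine_id hD.1 hD.1 hDG _
    calc (Dp * specFun hM.1 φ).trace = (Dp * ((G * G) * specFun hM.1 φ)).trace := by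
          rw [hGG, Matrix.one_mul]
      _ = ((Dp * G) * specFun hM'.1 φ * G).trace := by
          rw [Matrix.mul_assoc G, h1]; simp only [Matrix.mul_assoc]
      _ = ((G * G) * Dp * specFun hM'.1 φ).trace := by
          rw [trace_mul_comm, ← h2]; simp only [Matrix.mul_assoc]
      _ = _ := by rw [hGG, Matrix.one_mul]
  have havg : (Dp * specFun hM.1 φ).trace.re = ((Dp * specFun hM.1 φ).trace.re +
      (Dp * specFun hM'.1 φ).trace.re) / 2 := by
    rw [← hflip]; ring
  have hDpt : trPow p D = (Dp * specFun hTH (fun _ => ((1 : ℝ) : ℂ))).trace.re := by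
    rw [trPow_eq_specFun hD.1, Complex.ofReal_one, specFun_one, Matrix.mul_one]
  have hDpos : Dp.PosSemidef := specFun_posSemidef _ fun i => by
    exact_mod_cast Real.rpow_nonneg (hD.eigenvalues_nonneg i) p
  rw [havg, specFun_comp hTH hM.1 _ (hspec l), specFun_comp hTH hM'.1 _ (hspec (-l)), hDpt,
    trace_mul_specFun, trace_mul_specFun, trace_mul_specFun]
  simp only [Complex.re_sum, φ, Complex.re_mul_ofReal, mul_one]
  rw [← Finset.sum_add_distrib, Finset.mul_sum, Finset.sum_div]
  refine Finset.sum_le_sum fun i _ => ?_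
  have hc := (Complex.le_def.1 ((hDpos.conjTranspose_mul_mul_same
      (hTH.eigenvectorUnitary : Matrix n n ℂ)).diag_nonneg (i := i))).1
  have hi := half_sum_rpow_le (t := hTH.eigenvalues i) hp hl
    ⟨by linarith [hτ 1 (by simp) i], by linarith [hτ (-1) (by simp) i]⟩
  rw [← mul_add, mul_div_assoc, mul_comm]
  refine mul_le_mul_of_nonneg_right ?_ hc
  rw [neg_mul, ← sub_eq_add_neg]
  linarith

/-! ### Phase damping on `ℂ^K ⊗ ℂ^2` -/

theorem pauliForm_apply {K : ℕ} (X : Matrix (Fin K) (Fin K) ℂ)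
    (Y : Fin 3 → Matrix (Fin K) (Fin K) ℂ) (i j : Fin K) (a b : Fin 2) :
    pauliForm X Y (i, a) (j, b) =
      !![(X + Y 2) i j, Y 0 i j - Complex.I * Y 1 i j;
        Y 0 i j + Complex.I * Y 1 i j, (X - Y 2) i j] a b := by
  simp only [pauliForm, Fin.sum_univ_three, Matrix.add_apply, kroneckerMap_apply, pauli]
  fin_cases a <;> fin_cases b <;> simp <;> ring

theorem exists_eq_pauliForm {K : ℕ} (ρ : Matrix (Fin K × Fin 2) (Fin K × Fin 2) ℂ) :
    ∃ X Y, ρ = pauliForm X Y := by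
  refine ⟨Matrix.of fun i j => (ρ (i, 0) (j, 0) + ρ (i, 1) (j, 1)) / 2,
    ![Matrix.of fun i j => (ρ (i, 0) (j, 1) + ρ (i, 1) (j, 0)) / 2,
      Matrix.of fun i j => Complex.I * (ρ (i, 0) (j, 1) - ρ (i, 1) (j, 0)) / 2,
      Matrix.of fun i j => (ρ (i, 0) (j, 0) - ρ (i, 1) (j, 1)) / 2], ?_⟩
  ext ⟨i, a⟩ ⟨j, b⟩
  rw [pauliForm_apply]
  fin_cases a <;> fin_cases b <;> simp <;> ring_nf <;> simp <;> ring

/-- The matrix `I ⊗ σ₃`: conjugation by it changes the sign of the off-diagonal blocks. -/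
def signFlip (K : ℕ) : Matrix (Fin K × Fin 2) (Fin K × Fin 2) ℂ :=
  diagonal fun x => if x.2 = 0 then 1 else -1

theorem signFlip_conjTranspose (K : ℕ) : (signFlip K)ᴴ = signFlip K := by
  rw [signFlip, diagonal_conjTranspose]
  congr 1; ext x; simp only [Pi.star_apply]; split_ifs <;> simp

theorem signFlip_mul_self (K : ℕ) : signFlip K * signFlip K = 1 := by
  rw [signFlip, diagonal_mul_diagonal, ← diagonal_one]
  congr 1; ext x; split_ifs <;> simp

theorem idTensor_phaseDamping_zero_add_self {K : ℕ}
    (ρ : Matrix (Fin K × Fin 2) (Fin K × Fin 2) ℂ) :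
    idTensor K (phaseDamping 0) ρ + idTensor K (phaseDamping 0) ρ =
      ρ + signFlip K * ρ * signFlip K := by
  ext ⟨i, a⟩ ⟨j, b⟩
  simp only [Matrix.add_apply, signFlip, mul_diagonal, diagonal_mul, idTensor, phaseDamping]
  fin_cases a <;> fin_cases b <;> simp

theorem idTensor_phaseDamping_eq {K : ℕ} (ρ : Matrix (Fin K × Fin 2) (Fin K × Fin 2) ℂ) (l : ℝ) :
    idTensor K (phaseDamping l) ρ = idTensor K (phaseDamping 0) ρ +
      (l : ℂ) • (ρ - idTensor K (phaseDamping 0) ρ) := by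
  ext ⟨i, a⟩ ⟨j, b⟩
  simp only [Matrix.add_apply, Matrix.smul_apply, Matrix.sub_apply, idTensor, phaseDamping]
  fin_cases a <;> fin_cases b <;> simp

theorem idTensor_phaseDamping_posSemidef {K : ℕ}
    {ρ : Matrix (Fin K × Fin 2) (Fin K × Fin 2) ℂ} (hρ : ρ.PosSemidef) {l : ℝ}
    (hl : l ∈ Set.Icc (-1 : ℝ) 1) : (idTensor K (phaseDamping l) ρ).PosSemidef := by
  have h : idTensor K (phaseDamping l) ρ = (((1 + l) / 2 : ℝ) : ℂ) • ρ +
      (((1 - l) / 2 : ℝ) : ℂ) • ((signFlip K)ᴴ * ρ * signFlip K) := by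
    rw [signFlip_conjTranspose]
    ext ⟨i, a⟩ ⟨j, b⟩
    simp only [Matrix.add_apply, Matrix.smul_apply, signFlip, mul_diagonal, diagonal_mul,
      idTensor, phaseDamping]
    fin_cases a <;> fin_cases b <;> simp <;> ring
  rw [h]
  refine (hρ.smul ?_).add ((hρ.conjTranspose_mul_mul_same _).smul ?_)
  · exact_mod_cast (by linarith [hl.1] : 0 ≤ (1 + l) / 2)
  · exact_mod_cast (by linarith [hl.2] : 0 ≤ (1 - l) / 2)

theorem diagBlock_posSemidef {K : ℕ} {ρ : Matrix (Fin K × Fin 2) (Fin K × Fin 2) ℂ}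
    (hρ : ρ.PosSemidef) (a : Fin 2) :
    (ρ.submatrix (fun i => (i, a)) (fun i => (i, a))).PosSemidef := hρ.submatrix _

theorem trPow_idTensor_phaseDamping_zero {K : ℕ}
    {ρ : Matrix (Fin K × Fin 2) (Fin K × Fin 2) ℂ} (hρ : ρ.PosSemidef) (p : ℝ) :
    trPow p (idTensor K (phaseDamping 0) ρ) =
      ∑ a, trPow p (ρ.submatrix (fun i => (i, a)) (fun i => (i, a))) := by
  have hD := idTensor_phaseDamping_posSemidef hρ (l := 0) (by simp)
  set D := idTensor K (phaseDamping 0) ρ with hDdef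
  let φ : ℝ → ℂ := fun x => ((x ^ p : ℝ) : ℂ)
  have hblock (a : Fin 2) (i : Fin K) : specFun hD.1 φ (i, a) (i, a) =
      specFun (diagBlock_posSemidef hρ a).1 φ i i := by
    -- the inclusion of the `a`-th block
    let J : Matrix (Fin K × Fin 2) (Fin K) ℂ := Matrix.of fun x j => if x = (j, a) then 1 else 0
    have hJ : J * ρ.submatrix (fun i => (i, a)) (fun i => (i, a)) = D * J := by
      ext ⟨k, b⟩ j
      simp only [J, Matrix.mul_apply, of_apply, mul_ite, mul_one, mul_zero, ite_mul, one_mul,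
        zero_mul, Finset.sum_ite_eq', Finset.mem_univ, if_true, submatrix_apply, Prod.mk.injEq,
        hDdef, idTensor, phaseDamping]
      fin_cases a <;> fin_cases b <;> simp
    have h := congrFun (congrFun (specFun_intertwine_id (diagBlock_posSemidef hρ a).1 hD.1 hJ φ)
      (i, a)) i
    simpa [J, Matrix.mul_apply] using h.symm
  rw [trPow_eq_specFun hD.1, trace, Fintype.sum_prod_type_right, Complex.re_sum]
  refine Finset.sum_congr rfl fun a _ => ?_
  rw [trPow_eq_specFun (diagBlock_posSemidef hρ a).1, trace]
  simp only [diag_apply]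
  congr 1
  exact Finset.sum_congr rfl fun i _ => hblock a i

/-! ### Taking `p`-th roots -/

theorem rpow_le_mFun_mul {p l s t : ℝ} (hp : 1 ≤ p) (hl : l ∈ Set.Icc (-1 : ℝ) 1) (hs : 0 ≤ s)
    (ht : 0 ≤ t) (h : s ≤ ((1 + l) ^ p + (1 - l) ^ p) / 2 * t) :
    s ^ (1 / p) ≤ 2 * mFun p l * (t / 2) ^ (1 / p) := by
  have hp0 : p ≠ 0 := by linarith
  have h1 : 0 ≤ 1 + l := by linarith [hl.1]
  have h2 : 0 ≤ 1 - l := by linarith [hl.2]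
  have hm : (2 : ℝ) = ((2 : ℝ) ^ p) ^ (1 / p) := by
    rw [← Real.rpow_mul zero_le_two, mul_one_div_cancel hp0, Real.rpow_one]
  have h3 : 0 ≤ ((1 + l) / 2) ^ p + ((1 - l) / 2) ^ p := by positivity
  have h2p : (2 : ℝ) ^ p * (((1 + l) / 2) ^ p + ((1 - l) / 2) ^ p) = (1 + l) ^ p + (1 - l) ^ p := by
    rw [Real.div_rpow h1 zero_le_two, Real.div_rpow h2 zero_le_two]
    field_simp
  have : 2 * mFun p l * (t / 2) ^ (1 / p) =
      (((1 + l) ^ p + (1 - l) ^ p) / 2 * t) ^ (1 / p) := by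
    rw [mFun]
    nth_rw 1 [hm]
    rw [← Real.mul_rpow (by positivity) h3, h2p, ← Real.mul_rpow (by positivity) (by positivity)]
    congr 1; ring
  rw [this]
  exact Real.rpow_le_rpow hs h (by positivity)

theorem inv_mFun_zero_mul_rpow {p t : ℝ} (hp : 1 ≤ p) (ht : 0 ≤ t) :
    (mFun p 0)⁻¹ * t ^ (1 / p) = 2 * (t / 2) ^ (1 / p) := by
  have hp0 : p ≠ 0 := by linarith
  have h1 : mFun p 0 = 2 ^ (1 / p) / 2 := by
    have : (((1 + 0) / 2 : ℝ)) ^ p + ((1 - 0) / 2) ^ p = 2 * (1 / 2) ^ p := by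
      norm_num; ring
    rw [mFun, this, Real.mul_rpow (by norm_num) (by positivity),
      ← Real.rpow_mul (by norm_num), mul_one_div_cancel hp0, Real.rpow_one]
    ring
  rw [h1, Real.div_rpow ht zero_le_two, inv_div]
  ring

end

theorem theorem2 (K : ℕ) (ρ : Matrix (Fin K × Fin 2) (Fin K × Fin 2) ℂ) (hρ : IsState ρ)
    (l : ℝ) (hl : l ∈ Set.Icc (-1 : ℝ) 1) (p : ℝ) (hp : 1 ≤ p) :
    (∃ X Y, ρ = pauliForm X Y) ∧
    (idTensor K (phaseDamping l) ρ).PosSemidef ∧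
    (∀ X Y, ρ = pauliForm X Y →
      (X + Y 2).PosSemidef ∧ (X - Y 2).PosSemidef ∧
      pNorm p (idTensor K (phaseDamping l) ρ) ≤
        2 * mFun p l * (1 / 2 * trPow p (X + Y 2) + 1 / 2 * trPow p (X - Y 2)) ^ (1 / p)) ∧
    pNorm p (idTensor K (phaseDamping l) ρ) ≤
      (mFun p 0)⁻¹ * mFun p l * pNorm p (idTensor K (phaseDamping 0) ρ) := by
  have hpos := hρ.1
  have hD := idTensor_phaseDamping_posSemidef hpos (l := 0) (by simp)
  have hS := idTensor_phaseDamping_posSemidef hpos hl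
  have hle : trPow p (idTensor K (phaseDamping l) ρ) ≤
      ((1 + l) ^ p + (1 - l) ^ p) / 2 * trPow p (idTensor K (phaseDamping 0) ρ) := by
    have h := hS
    rw [idTensor_phaseDamping_eq] at h ⊢
    exact trPow_dephasing_le hpos (signFlip_conjTranspose K) (signFlip_mul_self K) hD
      (idTensor_phaseDamping_zero_add_self ρ) hl hp h
  have hmain := rpow_le_mFun_mul hp hl (trPow_nonneg hS p) (trPow_nonneg hD p) hle
  refine ⟨exists_eq_pauliForm ρ, hS, fun X Y hXY => ?_, ?_⟩
  · have hA : ρ.submatrix (fun i => (i, 0)) (fun i => (i, 0)) = X + Y 2 := by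
      ext i j; rw [submatrix_apply, hXY, pauliForm_apply]; rfl
    have hB : ρ.submatrix (fun i => (i, 1)) (fun i => (i, 1)) = X - Y 2 := by
      ext i j; rw [submatrix_apply, hXY, pauliForm_apply]; rfl
    refine ⟨hA ▸ diagBlock_posSemidef hpos 0, hB ▸ diagBlock_posSemidef hpos 1, ?_⟩
    refine hmain.trans_eq ?_
    rw [trPow_idTensor_phaseDamping_zero hpos, Fin.sum_univ_two, hA, hB]
    congr 2; ring
  · refine hmain.trans_eq ?_
    rw [mul_right_comm, mul_right_comm (mFun p 0)⁻¹, pNorm,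
      inv_mFun_zero_mul_rpow hp (trPow_nonneg hD p)]
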